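/- Notation. For $t,s,h>0$ and $f\in C^\infty(\mathbf R^d)$ put $$\|f\|_{\mathcal S_{t,h}^s}=\sup_{\alpha,\beta\in\mathbf N^d,\ x\in\mathbf R^d}\frac{|x^\alpha\partial^\beta f(x)|}{h^{|\alpha+\beta|}\,\alpha!^t\,\beta!^s},$$ and let $\Sigma_t^s(\mathbf R^d)$ be the space of all $f\in C^\infty(\mathbf R^d)$ with $\|f\|_{\mathcal S_{t,h}^s}<\infty$ for every $h>0$, with the topology defined by these norms. Let $(\Sigma_t^s)'(\mathbf R^d)$ be the space of continuous conjugate linear functionals $\varphi\mapsto(u,\varphi)$ on $\Sigma_t^s(\mathbf R^d)$; a function $a$ on $\mathbf R^d$ belongs to it through $(a,\varphi)=\int_{\mathbf R^d} a(x)\overline{\varphi(x)}\,dx$, if these integrals converge absolutely and define a continuous functional. For $\psi\in\Sigma_t^s(\mathbf R^d)\setminus 0$ and $u\in(\Sigma_t^s)'(\mathbf R^d)$ let $$V_\psi u(x,\xi)=(2\pi)^{-d/2}\,\bigl(u,\ e^{i\langle\cdot,\xi\rangle}\psi(\cdot-x)\bigr),\qquad x,\xi\in\mathbf R^d.$$ The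 wave front set $\mathrm{WF}^{t,s}(u)$, with respect to the window $\psi$, is the set of all $(x_0,\xi_0)\in(\mathbf R^d\times\mathbf R^d)\setminus 0$ for which there is no open set $U\subseteq(\mathbf R^d\times\mathbf R^d)\setminus 0$ containing $(x_0,\xi_0)$ such that $$\sup_{\lambda>0,\ (x,\xi)\in U}e^{r\lambda}\,|V_\psi u(\lambda^t x,\lambda^s\xi)|<\infty\qquad\text{for all } r>0.$$ Proposition. Let $0<t\le 1$, $s>0$, $s+t>1$ and $z\in\mathbf C^d$, and write $\langle x,z\rangle=\sum_{j=1}^d x_jz_j$ for $x\in\mathbf R^d$. Then the function $x\mapsto e^{\langle x,z\rangle}$ belongs to $(\Sigma_t^s)'(\mathbf R^d)$, and for every window $\psi\in\Sigma_t^s(\mathbf R^d)\setminus 0$ $$\mathrm{WF}^{t,s}\bigl(e^{\langle\cdot,z\rangle}\bigr)=(\mathbf R^d\setminus 0)\times\{0\}.$$ -/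

import Mathlib

open scoped ContDiff ENNReal NNReal

namespace GelfandShilov

/-- Euclidean space `ℝ^d`. -/
abbrev Rd (d : ℕ) := EuclideanSpace ℝ (Fin d)

/-- The partial derivative `∂_j f`. -/
noncomputable def partialDeriv {d : ℕ} (j : Fin d) (f : Rd d → ℂ) :
    Rd d → ℂ :=
  fun x => fderiv ℝ f x (EuclideanSpace.single j 1)

/-- The partial derivative `∂^β f = ∂_1^{β_1} ⋯ ∂_d^{β_d} f` for a multi-index `β ∈ ℕ^d`. -/
noncomputable def multiDeriv {d : ℕ} (β : Fin d → ℕ) (f : Rd d → ℂ) :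
    Rd d → ℂ :=
  (List.finRange d).foldr (fun j g => (partialDeriv j)^[β j] g) f

/-- The monomial `x^α`. -/
noncomputable def monomial {d : ℕ} (α : Fin d → ℕ) (x : Rd d) : ℝ :=
  ∏ j, x j ^ α j

/-- The length `|α|` of a multi-index. -/
def length {d : ℕ} (α : Fin d → ℕ) : ℕ := ∑ j, α j

/-- The factorial `α!` of a multi-index. -/
def multiFactorial {d : ℕ} (α : Fin d → ℕ) : ℕ := ∏ j, (α j).factorial

/-- The norm of `𝓢_{t,h}^s(ℝ^d)`, the supremum over all `α, β ∈ ℕ^d` and `x ∈ ℝ^d` of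
`|x^α ∂^β f(x)| / (h^{|α + β|} α!^t β!^s)`, as an extended nonnegative number. -/
noncomputable def gsNorm {d : ℕ} (t s h : ℝ) (f : Rd d → ℂ) : ℝ≥0∞ :=
  ⨆ (α : Fin d → ℕ) (β : Fin d → ℕ) (x : Rd d),
    ENNReal.ofReal (‖(monomial α x : ℂ) * multiDeriv β f x‖ /
      (h ^ (length α + length β) * (multiFactorial α : ℝ) ^ t * (multiFactorial β : ℝ) ^ s))

variable {d : ℕ}

/-- Auxiliary: the iterated derivative `∂_{j_1} ⋯ ∂_{j_n} f` along a word `[j_1, …, j_n]`. -/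
noncomputable def wordDeriv (L : List (Fin d)) (f : Rd d → ℂ) : Rd d → ℂ := L.foldr partialDeriv f

/-- Auxiliary: the word `1 … 1 2 … 2 ⋯ d … d` with `β_j` letters `j`. -/
def word (β : Fin d → ℕ) : List (Fin d) :=
  (List.finRange d).flatMap fun j => List.replicate (β j) j

theorem multiDeriv_eq_wordDeriv (β : Fin d → ℕ) (f : Rd d → ℂ) :
    multiDeriv β f = wordDeriv (word β) f := by
  have h : ∀ l : List (Fin d), l.foldr (fun j g => (partialDeriv j)^[β j] g) f =
      wordDeriv (l.flatMap fun j => List.replicate (β j) j) f := by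
    intro l
    induction l with
    | nil => rfl
    | cons a l ih =>
      rw [List.foldr_cons, ih, List.flatMap_cons]
      unfold wordDeriv
      rw [List.foldr_append]
      generalize List.foldr partialDeriv f _ = g
      generalize β a = n
      induction n with
      | zero => rfl
      | succ n ihn => rw [Function.iterate_succ_apply', ihn, List.replicate_succ, List.foldr_cons]
  exact h _

theorem count_word (β : Fin d → ℕ) (j : Fin d) : (word β).count j = β j := by
  unfold word
  rw [List.count_flatMap]
  simp only [Function.comp_def, List.count_replicate]
  rw [← Fin.sum_univ_def]
  simp

theorem iteratedFDeriv_word {f : Rd d → ℂ} (hf : ContDiff ℝ ∞ f) (L : List (Fin d)) (x : Rd d) :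
    iteratedFDeriv ℝ L.length f x (fun i => EuclideanSpace.single (L.get i) 1) =
      wordDeriv L f x := by
  induction L generalizing x with
  | nil => simp [wordDeriv]
  | cons a L ih =>
    have hd : DifferentiableAt ℝ (iteratedFDeriv ℝ L.length f) x :=
      (hf.differentiable_iteratedFDeriv (by exact_mod_cast ENat.natCast_lt_top _)) x
    have h1 : wordDeriv (a :: L) f x = fderiv ℝ (wordDeriv L f) x (EuclideanSpace.single a 1) := rfl
    have h2 : wordDeriv L f = fun y => iteratedFDeriv ℝ L.length f y
        (fun i => EuclideanSpace.single (L.get i) 1) := by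
      ext y; rw [ih]
    rw [h1, h2]
    simp only [List.length_cons]
    rw [iteratedFDeriv_succ_apply_left, fderiv_continuousMultilinear_apply_const_apply hd]
    rfl

theorem contDiff_partialDeriv {f : Rd d → ℂ} (hf : ContDiff ℝ ∞ f) (j : Fin d) :
    ContDiff ℝ ∞ (partialDeriv j f) :=
  (hf.fderiv_right (m := ∞) le_rfl).clm_apply contDiff_const

theorem contDiff_wordDeriv {f : Rd d → ℂ} (hf : ContDiff ℝ ∞ f) (L : List (Fin d)) :
    ContDiff ℝ ∞ (wordDeriv L f) := by
  induction L with
  | nil => exact hf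
  | cons a L ih => exact contDiff_partialDeriv ih a

theorem partialDeriv_comm {f : Rd d → ℂ} (hf : ContDiff ℝ ∞ f) (i j : Fin d) :
    partialDeriv i (partialDeriv j f) = partialDeriv j (partialDeriv i f) := by
  have hd : Differentiable ℝ (fderiv ℝ f) :=
    (hf.fderiv_right (m := ∞) le_rfl).differentiable (by simp)
  ext x
  unfold partialDeriv
  rw [fderiv_clm_apply (hd x) (differentiableAt_const _),
    fderiv_clm_apply (hd x) (differentiableAt_const _)]
  have := (hf.contDiffAt (x := x)).isSymmSndFDerivAt
    (by rw [minSmoothness_of_isRCLikeNormedField]; exact WithTop.coe_le_coe.2 le_top)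
  simpa using this _ _

theorem wordDeriv_perm {f : Rd d → ℂ} (hf : ContDiff ℝ ∞ f) {L M : List (Fin d)} (h : L.Perm M) :
    wordDeriv L f = wordDeriv M f := by
  induction h with
  | nil => rfl
  | cons a _ ih => exact congrArg (partialDeriv a) ih
  | swap a b l => exact partialDeriv_comm (contDiff_wordDeriv hf l) b a
  | trans _ _ h1 h2 => exact h1.trans h2

theorem wordDeriv_eq_multiDeriv {f : Rd d → ℂ} (hf : ContDiff ℝ ∞ f) (L : List (Fin d)) :
    wordDeriv L f = multiDeriv (fun j => L.count j) f := by
  rw [multiDeriv_eq_wordDeriv]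
  refine wordDeriv_perm hf ?_
  rw [List.perm_iff_count]
  intro a
  rw [count_word]

theorem length_word (β : Fin d → ℕ) : (word β).length = length β := by
  unfold word
  rw [List.length_flatMap]
  simp only [List.length_replicate]
  rw [← Fin.sum_univ_def]; rfl


theorem gsNorm_lt_top_iff {t s h : ℝ} (hh : 0 < h) (f : Rd d → ℂ) :
    gsNorm t s h f < ⊤ ↔ ∃ C : ℝ, 0 ≤ C ∧ ∀ (α β : Fin d → ℕ) (x : Rd d),
      ‖(monomial α x : ℂ) * multiDeriv β f x‖ ≤
        C * (h ^ (length α + length β) * (multiFactorial α : ℝ) ^ t *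
          (multiFactorial β : ℝ) ^ s) := by
  have hpos : ∀ α β : Fin d → ℕ, 0 < h ^ (length α + length β) * (multiFactorial α : ℝ) ^ t *
          (multiFactorial β : ℝ) ^ s := by
    intro α β
    have h1 : (0 : ℝ) < multiFactorial α := by
      unfold multiFactorial; exact_mod_cast Finset.prod_pos fun j _ => Nat.factorial_pos _
    have h2 : (0 : ℝ) < multiFactorial β := by
      unfold multiFactorial; exact_mod_cast Finset.prod_pos fun j _ => Nat.factorial_pos _
    positivity
  constructor
  · intro hlt
    refine ⟨(gsNorm t s h f).toReal, ENNReal.toReal_nonneg, fun α β x => ?_⟩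
    rw [← div_le_iff₀ (hpos α β)]
    rw [← ENNReal.ofReal_le_iff_le_toReal hlt.ne]
    exact le_iSup_of_le α (le_iSup_of_le β (le_iSup_of_le x le_rfl))
  · rintro ⟨C, hC, hb⟩
    refine lt_of_le_of_lt (iSup_le fun α => iSup_le fun β => iSup_le fun x => ?_)
      (ENNReal.ofReal_lt_top (r := C))
    refine ENNReal.ofReal_le_ofReal ?_
    rw [div_le_iff₀ (hpos α β)]
    exact hb α β x

/-- Auxiliary: a coordinate-free form of the estimates that define `Σ_t^s(ℝ^d)`. -/
def NormBound (t s : ℝ) (f : Rd d → ℂ) : Prop :=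
  ∀ h : ℝ, 0 < h → ∃ C : ℝ, 0 ≤ C ∧ ∀ (k n : ℕ) (x : Rd d),
    ‖x‖ ^ k * ‖iteratedFDeriv ℝ n f x‖ ≤
      C * (h ^ (k + n) * (k.factorial : ℝ) ^ t * (n.factorial : ℝ) ^ s)

theorem multiFactorial_le (α : Fin d → ℕ) : multiFactorial α ≤ (length α).factorial :=
  Nat.le_of_dvd (Nat.factorial_pos _) (Nat.prod_factorial_dvd_factorial_sum _ _)

theorem factorial_le (α : Fin d → ℕ) :
    (length α).factorial ≤ d ^ length α * multiFactorial α := by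
  have h := Nat.multinomial_spec Finset.univ α
  have h2 : Nat.multinomial Finset.univ α ≤ d ^ length α := by
    have h3 := Finset.sum_pow_eq_sum_piAntidiag (Finset.univ : Finset (Fin d))
      (fun _ => (1 : ℕ)) (length α)
    simp only [Finset.sum_const, Finset.card_univ, Fintype.card_fin, smul_eq_mul, mul_one,
      one_pow, Finset.prod_const_one] at h3
    rw [h3]
    exact Finset.single_le_sum (f := fun k => Nat.multinomial Finset.univ k)
      (fun _ _ => Nat.zero_le _) (by simp [length])
  unfold length multiFactorial at *
  rw [← h, mul_comm]
  exact Nat.mul_le_mul_right _ h2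

theorem length_count (L : List (Fin d)) : length (fun j => L.count j) = L.length := by
  unfold length
  have := Multiset.sum_count_eq_card (s := Finset.univ) (m := (L : Multiset (Fin d)))
    (fun a _ => Finset.mem_univ a)
  simpa using this

theorem norm_pow_le (x : Rd d) (k : ℕ) :
    ‖x‖ ^ k ≤ ∑ p : Fin k → Fin d, |monomial (fun j => (List.ofFn p).count j) x| := by
  have h1 : ‖x‖ ≤ ∑ j, |x j| := by
    calc ‖x‖ = ‖∑ j, x j • EuclideanSpace.single j (1 : ℝ)‖ := by
          congr 1
          ext i
          simp [Finset.sum_apply, Pi.single_apply]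
      _ ≤ ∑ j, ‖x j • EuclideanSpace.single j (1 : ℝ)‖ := norm_sum_le _ _
      _ = ∑ j, |x j| := by simp [norm_smul]
  calc ‖x‖ ^ k ≤ (∑ j, |x j|) ^ k := by gcongr
    _ = ∏ _i : Fin k, ∑ j, |x j| := by simp
    _ = ∑ p : Fin k → Fin d, ∏ i, |x (p i)| := by
        rw [Finset.prod_univ_sum]; simp
    _ = _ := by
        refine Finset.sum_congr rfl fun p _ => ?_
        unfold monomial
        rw [Finset.abs_prod]
        simp only [abs_pow]
        have hL : ∀ L : List (Fin d), (L.map fun j => |x j|).prod = ∏ j, |x j| ^ L.count j := by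
          intro L
          induction L with
          | nil => simp
          | cons a L ih =>
            simp only [List.map_cons, List.prod_cons, ih, List.count_cons, pow_add,
              Finset.prod_mul_distrib]
            rw [mul_comm]
            congr 1
            rw [Finset.prod_eq_single a]
            · simp
            · intro b _ hb
              simp [Ne.symm hb]
            · simp
        rw [← hL, ← List.prod_ofFn, List.map_ofFn]
        rfl

theorem norm_iteratedFDeriv_le {f : Rd d → ℂ} (hf : ContDiff ℝ ∞ f) (n : ℕ) (x : Rd d) :
    ‖iteratedFDeriv ℝ n f x‖ ≤
      ∑ p : Fin n → Fin d, ‖multiDeriv (fun j => (List.ofFn p).count j) f x‖ := by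
  have key : ∀ p : Fin n → Fin d, iteratedFDeriv ℝ n f x
      (fun i => EuclideanSpace.single (p i) 1) =
        multiDeriv (fun j => (List.ofFn p).count j) f x := by
    intro p
    rw [← wordDeriv_eq_multiDeriv hf, ← iteratedFDeriv_word hf]
    have : ∀ (m : ℕ) (hm : m = n), iteratedFDeriv ℝ n f x
      (fun i => EuclideanSpace.single (p i) 1) = iteratedFDeriv ℝ m f x
      (fun i => EuclideanSpace.single (p (Fin.cast hm i)) 1) := by
      rintro m rfl; rfl
    rw [this _ (List.length_ofFn (f := p))]
    congr 1
    ext1 i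
    congr 1
    simp [Fin.cast]
  refine ContinuousMultilinearMap.opNorm_le_bound (by positivity) fun m => ?_
  have hm : m = fun i => ∑ j, m i j • EuclideanSpace.single j (1 : ℝ) := by
    ext i l
    simp [Finset.sum_apply, Pi.single_apply]
  conv_lhs => rw [hm]
  rw [ContinuousMultilinearMap.map_sum, Finset.sum_mul]
  refine (norm_sum_le _ _).trans (Finset.sum_le_sum fun p _ => ?_)
  rw [ContinuousMultilinearMap.map_smul_univ, norm_smul, key, mul_comm]
  refine mul_le_mul_of_nonneg_left ?_ (norm_nonneg _)
  rw [norm_prod]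
  exact Finset.prod_le_prod (fun _ _ => norm_nonneg _) fun i _ =>
    PiLp.norm_apply_le (m i) (p i)

theorem abs_monomial_le (α : Fin d → ℕ) (x : Rd d) : |monomial α x| ≤ ‖x‖ ^ length α := by
  unfold monomial length
  rw [Finset.abs_prod, ← Finset.prod_pow_eq_pow_sum]
  simp only [abs_pow]
  refine Finset.prod_le_prod (fun _ _ => by positivity) fun j _ => ?_
  gcongr
  exact PiLp.norm_apply_le x j

theorem norm_multiDeriv_le {f : Rd d → ℂ} (hf : ContDiff ℝ ∞ f) (β : Fin d → ℕ) (x : Rd d) :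
    ‖multiDeriv β f x‖ ≤ ‖iteratedFDeriv ℝ (length β) f x‖ := by
  rw [multiDeriv_eq_wordDeriv, ← iteratedFDeriv_word hf, ← length_word β]
  refine (ContinuousMultilinearMap.le_opNorm _ _).trans ?_
  simp

theorem normBound_of_gsNorm {t s : ℝ} (ht : 0 ≤ t) (hs : 0 ≤ s) {f : Rd d → ℂ}
    (hf : ContDiff ℝ ∞ f) (H : ∀ h : ℝ, 0 < h → gsNorm t s h f < ⊤) : NormBound t s f := by
  intro h hh
  have hD : (0 : ℝ) < d + 1 := by positivity
  have hh' : 0 < h / (d + 1) := by positivity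
  obtain ⟨C, hC, hb⟩ := (gsNorm_lt_top_iff hh' f).1 (H _ hh')
  refine ⟨C, hC, fun k n x => ?_⟩
  have hterm : ∀ (p : Fin k → Fin d) (q : Fin n → Fin d),
      |monomial (fun j => (List.ofFn p).count j) x| *
        ‖multiDeriv (fun j => (List.ofFn q).count j) f x‖ ≤
      C * ((h / (d + 1)) ^ (k + n) * (k.factorial : ℝ) ^ t * (n.factorial : ℝ) ^ s) := by
    intro p q
    have h1 := hb (fun j => (List.ofFn p).count j) (fun j => (List.ofFn q).count j) x
    have h2 := multiFactorial_le (fun j => (List.ofFn p).count j)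
    have h3 := multiFactorial_le (fun j => (List.ofFn q).count j)
    rw [length_count, List.length_ofFn] at h2 h3
    rw [norm_mul, Complex.norm_real, Real.norm_eq_abs, length_count, length_count,
      List.length_ofFn, List.length_ofFn] at h1
    refine h1.trans ?_
    gcongr
  calc ‖x‖ ^ k * ‖iteratedFDeriv ℝ n f x‖
      ≤ (∑ p : Fin k → Fin d, |monomial (fun j => (List.ofFn p).count j) x|) *
        ∑ q : Fin n → Fin d, ‖multiDeriv (fun j => (List.ofFn q).count j) f x‖ :=
        mul_le_mul (norm_pow_le x k) (norm_iteratedFDeriv_le hf n x) (norm_nonneg _)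
          (by positivity)
    _ ≤ ∑ _p : Fin k → Fin d, ∑ _q : Fin n → Fin d,
        C * ((h / (d + 1)) ^ (k + n) * (k.factorial : ℝ) ^ t * (n.factorial : ℝ) ^ s) := by
        rw [Finset.sum_mul_sum]
        exact Finset.sum_le_sum fun p _ => Finset.sum_le_sum fun q _ => hterm p q
    _ = C * ((d * (h / (d + 1))) ^ (k + n) * (k.factorial : ℝ) ^ t * (n.factorial : ℝ) ^ s) := by
        simp only [Finset.sum_const, Finset.card_univ, Fintype.card_pi, Fintype.card_fin,
          Finset.prod_const, nsmul_eq_mul, Nat.cast_pow]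
        rw [mul_pow, pow_add (d : ℝ)]
        ring
    _ ≤ _ := by
        have : d * (h / (d + 1)) ≤ h := by
          rw [mul_div_assoc', div_le_iff₀ hD]
          nlinarith
        gcongr

theorem gsNorm_of_normBound {t s : ℝ} (ht : 0 ≤ t) (hs : 0 ≤ s) {f : Rd d → ℂ}
    (hf : ContDiff ℝ ∞ f) (H : NormBound t s f) (h : ℝ) (hh : 0 < h) : gsNorm t s h f < ⊤ := by
  rw [gsNorm_lt_top_iff hh]
  have hD : (1 : ℝ) ≤ d + 1 := by simp
  have hA : (1 : ℝ) ≤ (d + 1 : ℝ) ^ t := Real.one_le_rpow hD ht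
  have hB : (1 : ℝ) ≤ (d + 1 : ℝ) ^ s := Real.one_le_rpow hD hs
  set A := (d + 1 : ℝ) ^ t with hAdef
  set B := (d + 1 : ℝ) ^ s with hBdef
  have hA0 : 0 < A := by linarith
  have hB0 : 0 < B := by linarith
  obtain ⟨C, hC, hb⟩ := H (h / (A * B)) (by positivity)
  refine ⟨C, hC, fun α β x => ?_⟩
  have hfac : ∀ (u : ℝ) (_ : 0 ≤ u) (γ : Fin d → ℕ), ((length γ).factorial : ℝ) ^ u ≤
      ((d + 1 : ℝ) ^ u) ^ length γ * (multiFactorial γ : ℝ) ^ u := by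
    intro u hu γ
    have h1 : ((length γ).factorial : ℝ) ≤ (d + 1 : ℝ) ^ length γ * multiFactorial γ := by
      calc ((length γ).factorial : ℝ) ≤ (d : ℝ) ^ length γ * multiFactorial γ := by
            exact_mod_cast factorial_le γ
        _ ≤ _ := by gcongr; linarith
    calc ((length γ).factorial : ℝ) ^ u ≤ ((d + 1 : ℝ) ^ length γ * multiFactorial γ) ^ u := by
          gcongr
      _ = _ := by
          rw [Real.mul_rpow (by positivity) (by positivity), ← Real.rpow_natCast,
            ← Real.rpow_mul (by positivity), mul_comm (length γ : ℝ), Real.rpow_mul (by positivity),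
            Real.rpow_natCast]
  have hpw : (h / (A * B)) ^ (length α + length β) * A ^ length α * B ^ length β ≤
      h ^ (length α + length β) := by
    have e1 : A ^ length α ≤ A ^ (length α + length β) := pow_le_pow_right₀ hA (by omega)
    have e2 : B ^ length β ≤ B ^ (length α + length β) := pow_le_pow_right₀ hB (by omega)
    calc _ ≤ (h / (A * B)) ^ (length α + length β) * A ^ (length α + length β) *
          B ^ (length α + length β) := by gcongr
      _ = _ := by rw [← mul_pow, ← mul_pow]; congr 1; field_simp
  rw [norm_mul, Complex.norm_real, Real.norm_eq_abs]
  calc |monomial α x| * ‖multiDeriv β f x‖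
      ≤ ‖x‖ ^ length α * ‖iteratedFDeriv ℝ (length β) f x‖ :=
        mul_le_mul (abs_monomial_le α x) (norm_multiDeriv_le hf β x) (norm_nonneg _)
          (by positivity)
    _ ≤ _ := hb _ _ x
    _ ≤ C * ((h / (A * B)) ^ (length α + length β) * (A ^ length α * (multiFactorial α : ℝ) ^ t) *
        (B ^ length β * (multiFactorial β : ℝ) ^ s)) := by
        gcongr
        · exact hfac t ht α
        · exact hfac s hs β
    _ = C * (((h / (A * B)) ^ (length α + length β) * A ^ length α * B ^ length β) *
        (multiFactorial α : ℝ) ^ t * (multiFactorial β : ℝ) ^ s) := by ring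
    _ ≤ _ := by gcongr

/-- Powers are dominated by factorials. -/
theorem pow_le_factorial (a : ℝ) (ha : 0 ≤ a) {h u : ℝ} (hh : 0 < h) (hu : 0 < u) :
    ∃ C : ℝ, 0 ≤ C ∧ ∀ n : ℕ, a ^ n ≤ C * (h ^ n * (n.factorial : ℝ) ^ u) := by
  set b := (a / h) ^ (1 / u) with hb
  have hb0 : 0 ≤ b := by positivity
  have hbu : b ^ u = a / h := by
    rw [hb, ← Real.rpow_mul (by positivity), one_div_mul_cancel hu.ne', Real.rpow_one]
  refine ⟨(Real.exp b) ^ u, by positivity, fun n => ?_⟩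
  have h1 : b ^ n ≤ Real.exp b * n.factorial := by
    have := Real.pow_div_factorial_le_exp b hb0 n
    rwa [div_le_iff₀ (by positivity)] at this
  have h2 : (b ^ n) ^ u ≤ (Real.exp b * n.factorial) ^ u := by gcongr
  rw [Real.mul_rpow (by positivity) (by positivity), ← Real.rpow_natCast, ← Real.rpow_mul hb0,
    mul_comm (n : ℝ), Real.rpow_mul hb0, hbu, Real.rpow_natCast, div_pow,
    div_le_iff₀ (by positivity)] at h2
  calc a ^ n ≤ _ := h2
    _ = _ := by ring

theorem NormBound.comp_sub {t s : ℝ} (ht : 0 < t) {f : Rd d → ℂ} (H : NormBound t s f) (y : Rd d) :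
    NormBound t s (fun x => f (x - y)) := by
  intro h hh
  have hh' : 0 < h / 2 := by positivity
  obtain ⟨C, hC, hb⟩ := H (h / 2) hh'
  obtain ⟨C', hC', hb'⟩ := pow_le_factorial ‖y‖ (norm_nonneg y) hh' ht
  refine ⟨C + C' * C, by positivity, fun k n x => ?_⟩
  rw [iteratedFDeriv_comp_sub]
  have h1 : ‖x‖ ^ k ≤ 2 ^ k * (‖x - y‖ ^ k + ‖y‖ ^ k) := by
    have e : ‖x‖ ≤ ‖x - y‖ + ‖y‖ := by simpa using norm_add_le (x - y) y
    calc ‖x‖ ^ k ≤ (‖x - y‖ + ‖y‖) ^ k := by gcongr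
      _ ≤ 2 ^ (k - 1) * (‖x - y‖ ^ k + ‖y‖ ^ k) :=
        _root_.add_pow_le (norm_nonneg _) (norm_nonneg _) k
      _ ≤ _ := by gcongr <;> norm_num
  have h2 := hb k n (x - y)
  have h3 := hb 0 n (x - y)
  simp only [pow_zero, one_mul, zero_add, Nat.factorial_zero, Nat.cast_one, Real.one_rpow,
    mul_one] at h3
  calc ‖x‖ ^ k * ‖iteratedFDeriv ℝ n f (x - y)‖
      ≤ 2 ^ k * (‖x - y‖ ^ k + ‖y‖ ^ k) * ‖iteratedFDeriv ℝ n f (x - y)‖ := by gcongr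
    _ = 2 ^ k * (‖x - y‖ ^ k * ‖iteratedFDeriv ℝ n f (x - y)‖ +
        ‖y‖ ^ k * ‖iteratedFDeriv ℝ n f (x - y)‖) := by ring
    _ ≤ 2 ^ k * (C * ((h / 2) ^ (k + n) * (k.factorial : ℝ) ^ t * (n.factorial : ℝ) ^ s) +
        (C' * ((h / 2) ^ k * (k.factorial : ℝ) ^ t)) *
          (C * ((h / 2) ^ n * (n.factorial : ℝ) ^ s))) := by
        gcongr
        exact hb' k
    _ = (C + C' * C) * (2 ^ k * (h / 2) ^ (k + n) * (k.factorial : ℝ) ^ t *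
          (n.factorial : ℝ) ^ s) := by rw [pow_add]; ring
    _ ≤ (C + C' * C) * (h ^ (k + n) * (k.factorial : ℝ) ^ t * (n.factorial : ℝ) ^ s) := by
        gcongr
        calc (2 : ℝ) ^ k * (h / 2) ^ (k + n) ≤ 2 ^ (k + n) * (h / 2) ^ (k + n) := by
              gcongr
              · norm_num
              · omega
          _ = h ^ (k + n) := by rw [← mul_pow]; congr 1; ring

theorem norm_iteratedFDeriv_character_le (ξ x : Rd d) (n : ℕ) :
    ‖iteratedFDeriv ℝ n (fun y : Rd d => Complex.exp (Complex.I * (inner ℝ y ξ : ℝ))) x‖ ≤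
      ‖ξ‖ ^ n := by
  have hd : ∀ n : ℕ, iteratedDeriv n (fun r : ℝ => Complex.exp (Complex.I * r)) =
      fun r : ℝ => Complex.I ^ n * Complex.exp (Complex.I * r) := by
    intro n
    induction n with
    | zero => ext r; simp
    | succ n ih =>
      rw [iteratedDeriv_succ, ih]
      ext r
      have h1 : HasDerivAt (fun r : ℝ => Complex.exp (Complex.I * r))
          (Complex.exp (Complex.I * r) * (Complex.I * 1)) r :=
        ((Complex.ofRealCLM.hasDerivAt (x := r)).const_mul Complex.I).cexp
      rw [(h1.const_mul (Complex.I ^ n)).deriv]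
      ring
  have hc : ContDiff ℝ ∞ (fun r : ℝ => Complex.exp (Complex.I * r)) :=
    (contDiff_const.mul Complex.ofRealCLM.contDiff).cexp
  have he : (fun y : Rd d => Complex.exp (Complex.I * (inner ℝ y ξ : ℝ))) =
      (fun r : ℝ => Complex.exp (Complex.I * r)) ∘ (innerSL ℝ ξ) := by
    ext y
    simp [real_inner_comm]
  rw [he, ContinuousLinearMap.iteratedFDeriv_comp_right _ hc x
    (i := n) (by exact_mod_cast le_top)]
  refine (ContinuousMultilinearMap.norm_compContinuousLinearMap_le _ _).trans ?_
  rw [norm_iteratedFDeriv_eq_norm_iteratedDeriv, hd]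
  simp [Complex.norm_exp]

theorem contDiff_character (ξ : Rd d) :
    ContDiff ℝ ∞ (fun y : Rd d => Complex.exp (Complex.I * (inner ℝ y ξ : ℝ))) :=
  (contDiff_const.mul (Complex.ofRealCLM.contDiff.comp (contDiff_id.inner ℝ contDiff_const))).cexp

theorem NormBound.modulation {t s : ℝ} (hs : 0 < s) {f : Rd d → ℂ}
    (hf : ContDiff ℝ ∞ f) (H : NormBound t s f) (ξ : Rd d) :
    NormBound t s (fun x => Complex.exp (Complex.I * (inner ℝ x ξ : ℝ)) * f x) := by
  intro h hh
  have hh' : 0 < h / 2 := by positivity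
  obtain ⟨C, hC, hb⟩ := H (h / 2) hh'
  obtain ⟨C', hC', hb'⟩ := pow_le_factorial ‖ξ‖ (norm_nonneg ξ) hh' hs
  refine ⟨C' * C, by positivity, fun k n x => ?_⟩
  have h1 := norm_iteratedFDeriv_mul_le (contDiff_character ξ) hf x (n := n)
    (by exact_mod_cast le_top)
  have hterm : ∀ i ∈ Finset.range (n + 1), ‖x‖ ^ k * ((n.choose i : ℝ) *
      ‖iteratedFDeriv ℝ i (fun y : Rd d => Complex.exp (Complex.I * (inner ℝ y ξ : ℝ))) x‖ *
      ‖iteratedFDeriv ℝ (n - i) f x‖) ≤ (n.choose i : ℝ) * (C' * C *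
        ((h / 2) ^ (k + n) * (k.factorial : ℝ) ^ t * (n.factorial : ℝ) ^ s)) := by
    intro i hi
    have hi' : i ≤ n := by simpa [Nat.lt_succ_iff] using hi
    have e1 : ‖iteratedFDeriv ℝ i
        (fun y : Rd d => Complex.exp (Complex.I * (inner ℝ y ξ : ℝ))) x‖ ≤
        C' * ((h / 2) ^ i * (i.factorial : ℝ) ^ s) :=
      (norm_iteratedFDeriv_character_le ξ x i).trans (hb' i)
    have e2 := hb k (n - i) x
    have e3 : (i.factorial : ℝ) ^ s * ((n - i).factorial : ℝ) ^ s ≤ (n.factorial : ℝ) ^ s := by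
      rw [← Real.mul_rpow (by positivity) (by positivity)]
      gcongr
      exact_mod_cast Nat.le_of_dvd (Nat.factorial_pos _) (Nat.factorial_mul_factorial_dvd_factorial hi')
    have e4 : (h / 2) ^ i * (h / 2) ^ (k + (n - i)) = (h / 2) ^ (k + n) := by
      rw [← pow_add]; congr 1; omega
    calc _ = (n.choose i : ℝ) *
          (‖iteratedFDeriv ℝ i (fun y : Rd d => Complex.exp (Complex.I * (inner ℝ y ξ : ℝ))) x‖ *
          (‖x‖ ^ k * ‖iteratedFDeriv ℝ (n - i) f x‖)) := by ring
      _ ≤ (n.choose i : ℝ) * ((C' * ((h / 2) ^ i * (i.factorial : ℝ) ^ s)) *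
          (C * ((h / 2) ^ (k + (n - i)) * (k.factorial : ℝ) ^ t *
            ((n - i).factorial : ℝ) ^ s))) := by gcongr
      _ = (n.choose i : ℝ) * (C' * C * (((h / 2) ^ i * (h / 2) ^ (k + (n - i))) *
          (k.factorial : ℝ) ^ t *
          ((i.factorial : ℝ) ^ s * ((n - i).factorial : ℝ) ^ s))) := by ring
      _ ≤ _ := by rw [e4]; gcongr
  calc _ ≤ ‖x‖ ^ k * _ := mul_le_mul_of_nonneg_left h1 (by positivity)
    _ ≤ ∑ i ∈ Finset.range (n + 1), (n.choose i : ℝ) * (C' * C *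
        ((h / 2) ^ (k + n) * (k.factorial : ℝ) ^ t * (n.factorial : ℝ) ^ s)) := by
        rw [Finset.mul_sum]
        exact Finset.sum_le_sum hterm
    _ = C' * C * ((2 ^ n * (h / 2) ^ (k + n)) * (k.factorial : ℝ) ^ t *
        (n.factorial : ℝ) ^ s) := by
        rw [← Finset.sum_mul]
        have : ∑ i ∈ Finset.range (n + 1), (n.choose i : ℝ) = 2 ^ n := by
          exact_mod_cast Nat.sum_range_choose n
        rw [this]; ring
    _ ≤ _ := by
        gcongr
        calc (2 : ℝ) ^ n * (h / 2) ^ (k + n) ≤ 2 ^ (k + n) * (h / 2) ^ (k + n) := by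
              gcongr
              · norm_num
              · omega
          _ = h ^ (k + n) := by rw [← mul_pow]; congr 1; ring

theorem wordDeriv_add {f g : Rd d → ℂ} (hf : ContDiff ℝ ∞ f) (hg : ContDiff ℝ ∞ g)
    (L : List (Fin d)) : wordDeriv L (f + g) = wordDeriv L f + wordDeriv L g := by
  induction L with
  | nil => rfl
  | cons a L ih =>
    change partialDeriv a (wordDeriv L (f + g)) =
      partialDeriv a (wordDeriv L f) + partialDeriv a (wordDeriv L g)
    ext x
    rw [ih]
    unfold partialDeriv
    rw [fderiv_add ((contDiff_wordDeriv hf L).differentiable (by simp) x)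
      ((contDiff_wordDeriv hg L).differentiable (by simp) x)]
    rfl

theorem wordDeriv_smul {f : Rd d → ℂ} (hf : ContDiff ℝ ∞ f) (c : ℂ) (L : List (Fin d)) :
    wordDeriv L (c • f) = c • wordDeriv L f := by
  induction L with
  | nil => rfl
  | cons a L ih =>
    change partialDeriv a (wordDeriv L (c • f)) = c • partialDeriv a (wordDeriv L f)
    ext x
    rw [ih]
    unfold partialDeriv
    rw [fderiv_const_smul ((contDiff_wordDeriv hf L).differentiable (by simp) x)]
    rfl

theorem wordDeriv_zero (L : List (Fin d)) : wordDeriv L (0 : Rd d → ℂ) = 0 := by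
  have := wordDeriv_smul (f := (0 : Rd d → ℂ)) contDiff_const 0 L
  simpa using this

/-- The Beurling type Gelfand-Shilov space `Σ_t^s(ℝ^d) = ⋂_{h > 0} 𝓢_{t,h}^s(ℝ^d)`. -/
def gelfandShilovSpace (d : ℕ) (t s : ℝ) : Submodule ℂ (Rd d → ℂ) where
  carrier := {f | ContDiff ℝ ∞ f ∧ ∀ h : ℝ, 0 < h → gsNorm t s h f < ⊤}
  zero_mem' := by
    refine ⟨contDiff_const, fun h hh => (gsNorm_lt_top_iff hh _).2 ⟨0, le_rfl, fun α β x => ?_⟩⟩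
    rw [multiDeriv_eq_wordDeriv, wordDeriv_zero]
    simp
  add_mem' := by
    rintro f g ⟨hf, Hf⟩ ⟨hg, Hg⟩
    refine ⟨hf.add hg, fun h hh => ?_⟩
    obtain ⟨C, hC, hb⟩ := (gsNorm_lt_top_iff hh f).1 (Hf h hh)
    obtain ⟨C', hC', hb'⟩ := (gsNorm_lt_top_iff hh g).1 (Hg h hh)
    refine (gsNorm_lt_top_iff hh _).2 ⟨C + C', by positivity, fun α β x => ?_⟩
    have h1 := hb α β x
    have h2 := hb' α β x
    rw [multiDeriv_eq_wordDeriv] at h1 h2 ⊢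
    rw [wordDeriv_add hf hg, Pi.add_apply, mul_add, add_mul]
    exact (norm_add_le _ _).trans (add_le_add h1 h2)
  smul_mem' := by
    rintro c f ⟨hf, Hf⟩
    refine ⟨hf.const_smul c, fun h hh => ?_⟩
    obtain ⟨C, hC, hb⟩ := (gsNorm_lt_top_iff hh f).1 (Hf h hh)
    refine (gsNorm_lt_top_iff hh _).2 ⟨‖c‖ * C, by positivity, fun α β x => ?_⟩
    have h1 := hb α β x
    rw [multiDeriv_eq_wordDeriv] at h1 ⊢
    rw [wordDeriv_smul hf, Pi.smul_apply, smul_eq_mul, mul_left_comm, norm_mul, mul_assoc]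
    exact mul_le_mul_of_nonneg_left h1 (norm_nonneg c)

/-- The time-frequency shift `M_ξ T_x f`, that is `y ↦ e^{i⟨y, ξ⟩} f(y - x)`. -/
noncomputable def timeFreqShift (x ξ : Rd d) (f : Rd d → ℂ) : Rd d → ℂ :=
  fun y => Complex.exp (Complex.I * (inner ℝ y ξ : ℝ)) * f (y - x)

theorem timeFreqShift_mem {t s : ℝ} (ht : 0 < t) (hs : 0 < s) (x ξ : Rd d) {f : Rd d → ℂ}
    (hf : f ∈ gelfandShilovSpace d t s) : timeFreqShift x ξ f ∈ gelfandShilovSpace d t s := by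
  have hf1 : ContDiff ℝ ∞ f := hf.1
  have hsub : ContDiff ℝ ∞ (fun y => f (y - x)) := hf1.comp (contDiff_id.sub contDiff_const)
  have hmul : ContDiff ℝ ∞ (timeFreqShift x ξ f) := (contDiff_character ξ).mul hsub
  exact ⟨hmul, gsNorm_of_normBound ht.le hs.le hmul
    (((normBound_of_gsNorm ht.le hs.le hf1 hf.2).comp_sub ht x).modulation hs hsub ξ)⟩

/-- The space `(Σ_t^s)'(ℝ^d)` of Gelfand-Shilov ultradistributions. An element `u` acts as a
conjugate linear functional `φ ↦ (u, φ)` on `Σ_t^s(ℝ^d)`, and it is continuous: it is bounded by a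
multiple of one of the norms of `𝓢_{t,h}^s(ℝ^d)`, `h > 0`, which define the topology of
`Σ_t^s(ℝ^d)` and increase when `h` decreases. -/
structure Ultradistribution (d : ℕ) (t s : ℝ) where
  pairing : gelfandShilovSpace d t s →ₛₗ[starRingEnd ℂ] ℂ
  continuous' : ∃ h : ℝ, 0 < h ∧ ∃ C : ℝ≥0, ∀ φ : gelfandShilovSpace d t s,
    ‖pairing φ‖ₑ ≤ C * gsNorm t s h (φ : Rd d → ℂ)

/-- The ultradistribution `u` is the function `a`: `(u, φ) = ∫ a(x) conj(φ(x)) dx` for all test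
functions `φ`, with absolutely convergent integrals. -/
def Ultradistribution.IsFunction {t s : ℝ} (u : Ultradistribution d t s) (a : Rd d → ℂ) : Prop :=
  ∀ φ : gelfandShilovSpace d t s,
    MeasureTheory.Integrable (fun x => a x * starRingEnd ℂ ((φ : Rd d → ℂ) x)) ∧
      u.pairing φ = ∫ x, a x * starRingEnd ℂ ((φ : Rd d → ℂ) x)

/-- The short-time Fourier transform `V_ψ u(x, ξ) = (2π)^{-d/2} (u, M_ξ T_x ψ)`. -/
noncomputable def stft {t s : ℝ} (ht : 0 < t) (hs : 0 < s) (ψ : gelfandShilovSpace d t s)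
    (u : Ultradistribution d t s) (x ξ : Rd d) : ℂ :=
  (((2 * Real.pi) ^ (-(d : ℝ) / 2) : ℝ) : ℂ) *
    u.pairing ⟨timeFreqShift x ξ (ψ : Rd d → ℂ), timeFreqShift_mem ht hs x ξ ψ.2⟩

/-- The `t,s`-Gelfand-Shilov wave front set `WF^{t,s}(u) ⊆ T^*ℝ^d ∖ 0` of `u`, computed with the
window function `ψ ∈ Σ_t^s(ℝ^d) ∖ 0`. -/
def waveFrontSet {t s : ℝ} (ht : 0 < t) (hs : 0 < s) (ψ : gelfandShilovSpace d t s)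
    (u : Ultradistribution d t s) : Set (Rd d × Rd d) :=
  {p | p ≠ 0 ∧ ¬ ∃ U : Set (Rd d × Rd d), IsOpen U ∧ 0 ∉ U ∧ p ∈ U ∧
    ∀ r : ℝ, 0 < r → ∃ C : ℝ, ∀ l : ℝ, 0 < l → ∀ q ∈ U,
      Real.exp (r * l) * ‖stft ht hs ψ u (l ^ t • q.1) (l ^ s • q.2)‖ ≤ C}

end GelfandShilov

/-! For `u = e^L` with `L x = ⟨x, z⟩`, the short-time Fourier transform factorizes: `|V_ψ u(x, ξ)|`
is a constant times `e^{Re L x} |G(ξ)|`, where `G` is the Fourier transform of `e^L conj ψ`. As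
`t ≤ 1`, elements of `Σ_t^s` decay faster than every `e^{-R‖x‖}`. Hence `e^L` pairs absolutely with
them, and `e^L conj ψ` is of Gevrey order `s` in the sense of Beurling with integrable derivatives,
so `G(ξ) = O(e^{-r‖ξ‖^{1/s}})` for all `r > 0`. Under the scaling `(λ^t x, λ^s ξ)` the first factor
lies between `e^{-R(1 + λ)}` and `e^{R(1 + λ)}` for some `R`, again because `t ≤ 1`. The decay of
`G` beats it wherever `ξ ≠ 0`, while at the points `(x, λ^{-s} η)` with `G(η) ≠ 0`, which approach
`(x, 0)`, the transform decays at most like a fixed exponential. -/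

namespace GelfandShilov

open MeasureTheory Filter Topology
open scoped FourierTransform

section FactorialMoments

theorem exp_mul_le_of_forall_pow_mul_le {a b M : ℝ}
    (h : ∀ n : ℕ, a ^ n * b ≤ M * ((1 / 2) ^ n * (n.factorial : ℝ))) :
    Real.exp a * b ≤ 2 * M := by
  have hexp : HasSum (fun n : ℕ => a ^ n / (n.factorial : ℝ) * b) (Real.exp a * b) := by
    rw [Real.exp_eq_exp_ℝ]
    exact (NormedSpace.expSeries_div_hasSum_exp a).mul_right b
  have hgeom : HasSum (fun n : ℕ => M * (1 / 2 : ℝ) ^ n) (M * 2) :=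
    hasSum_geometric_two.mul_left M
  rw [mul_comm 2]
  refine hasSum_le (fun n => ?_) hexp hgeom
  rw [div_mul_eq_mul_div, div_le_iff₀ (by positivity), mul_assoc]
  exact h n

theorem exp_rpow_mul_le_of_forall_pow_rpow_mul_le {a b M s : ℝ} (hs : 0 < s) (ha : 0 ≤ a)
    (hb : 0 ≤ b) (hM : 0 ≤ M)
    (h : ∀ n : ℕ, (a ^ n) ^ s * b ≤ M * ((1 / 2) ^ n * (n.factorial : ℝ)) ^ s) :
    Real.exp a ^ s * b ≤ 2 ^ s * M := by
  obtain ⟨b, hb₀, rfl⟩ : ∃ c : ℝ, 0 ≤ c ∧ c ^ s = b :=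
    ⟨b ^ s⁻¹, by positivity, Real.rpow_inv_rpow hb hs.ne'⟩
  obtain ⟨M, hM₀, rfl⟩ : ∃ c : ℝ, 0 ≤ c ∧ c ^ s = M :=
    ⟨M ^ s⁻¹, by positivity, Real.rpow_inv_rpow hM hs.ne'⟩
  rw [← Real.mul_rpow (by positivity) hb₀, ← Real.mul_rpow (by positivity) hM₀]
  refine Real.rpow_le_rpow (by positivity) (exp_mul_le_of_forall_pow_mul_le fun n => ?_) hs.le
  rw [← Real.rpow_le_rpow_iff (by positivity) (by positivity) hs,
    Real.mul_rpow (by positivity) hb₀, Real.mul_rpow hM₀ (by positivity)]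
  exact h n

theorem factorial_rpow_le {t : ℝ} (ht1 : t ≤ 1) (n : ℕ) :
    (n.factorial : ℝ) ^ t ≤ (n.factorial : ℝ) :=
  Real.rpow_le_self_of_one_le (by exact_mod_cast n.factorial_pos) ht1

theorem factorial_rpow_mul_factorial_rpow_le {s : ℝ} (hs : 0 ≤ s) {i n : ℕ} (hi : i ≤ n) :
    (i.factorial : ℝ) ^ s * ((n - i).factorial : ℝ) ^ s ≤ (n.factorial : ℝ) ^ s := by
  rw [← Real.mul_rpow (by positivity) (by positivity)]
  gcongr
  exact_mod_cast Nat.le_of_dvd n.factorial_pos (Nat.factorial_mul_factorial_dvd_factorial hi)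

end FactorialMoments

section BeurlingGevrey

variable {E F : Type*} [NormedAddCommGroup E] [NormedSpace ℝ E] [NormedAddCommGroup F]
  [NormedSpace ℝ F]

/-- The Gevrey class of order `s` and Beurling type with exponential weight: the smooth functions
`f` such that, for every `h > 0`, `‖D^n f(x)‖` is bounded by a multiple of `h^n n!^s e^{ρ‖x‖}`
uniformly in `n` and `x`. A negative `ρ` means decay. -/
structure IsBeurlingGevrey (s ρ : ℝ) (f : E → F) : Prop where
  contDiff : ContDiff ℝ ∞ f
  exists_bound : ∀ h : ℝ, 0 < h → ∃ C : ℝ, 0 ≤ C ∧ ∀ (n : ℕ) (x : E),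
    ‖iteratedFDeriv ℝ n f x‖ ≤ C * (h ^ n * (n.factorial : ℝ) ^ s) * Real.exp (ρ * ‖x‖)

theorem IsBeurlingGevrey.mul {A : Type*} [NormedRing A] [NormedAlgebra ℝ A] {s ρ σ : ℝ}
    (hs : 0 ≤ s) {f g : E → A} (hf : IsBeurlingGevrey s ρ f) (hg : IsBeurlingGevrey s σ g) :
    IsBeurlingGevrey s (ρ + σ) fun x => f x * g x := by
  refine ⟨hf.contDiff.mul hg.contDiff, fun h hh => ?_⟩
  obtain ⟨C, hC, hfC⟩ := hf.exists_bound (h / 2) (by positivity)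
  obtain ⟨D, hD, hgD⟩ := hg.exists_bound (h / 2) (by positivity)
  refine ⟨C * D, by positivity, fun n x => ?_⟩
  have term_le : ∀ i ∈ Finset.range (n + 1),
      n.choose i * ‖iteratedFDeriv ℝ i f x‖ * ‖iteratedFDeriv ℝ (n - i) g x‖ ≤
        n.choose i *
          (C * D * ((h / 2) ^ n * (n.factorial : ℝ) ^ s) * Real.exp ((ρ + σ) * ‖x‖)) := by
    intro i hi
    have hin : i ≤ n := Finset.mem_range_succ_iff.1 hi
    rw [mul_assoc]
    refine mul_le_mul_of_nonneg_left ?_ (by positivity)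
    calc ‖iteratedFDeriv ℝ i f x‖ * ‖iteratedFDeriv ℝ (n - i) g x‖
        ≤ (C * ((h / 2) ^ i * (i.factorial : ℝ) ^ s) * Real.exp (ρ * ‖x‖)) *
            (D * ((h / 2) ^ (n - i) * ((n - i).factorial : ℝ) ^ s) * Real.exp (σ * ‖x‖)) := by
          gcongr
          exacts [hfC i x, hgD (n - i) x]
      _ = C * D * ((h / 2) ^ n * ((i.factorial : ℝ) ^ s * ((n - i).factorial : ℝ) ^ s)) *
            Real.exp ((ρ + σ) * ‖x‖) := by
          rw [add_mul, Real.exp_add, ← pow_mul_pow_sub (h / 2) hin]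
          ring
      _ ≤ _ := by
          gcongr
          exact factorial_rpow_mul_factorial_rpow_le hs hin
  have sum_choose : ∑ i ∈ Finset.range (n + 1), (n.choose i : ℝ) = 2 ^ n := by
    exact_mod_cast Nat.sum_range_choose n
  calc ‖iteratedFDeriv ℝ n (fun y => f y * g y) x‖
      ≤ ∑ i ∈ Finset.range (n + 1),
          n.choose i * ‖iteratedFDeriv ℝ i f x‖ * ‖iteratedFDeriv ℝ (n - i) g x‖ :=
        norm_iteratedFDeriv_mul_le hf.contDiff hg.contDiff x (by exact_mod_cast le_top)
    _ ≤ 2 ^ n * (C * D * ((h / 2) ^ n * (n.factorial : ℝ) ^ s) * Real.exp ((ρ + σ) * ‖x‖)) := by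
        rw [← sum_choose, Finset.sum_mul]
        exact Finset.sum_le_sum term_le
    _ = C * D * (h ^ n * (n.factorial : ℝ) ^ s) * Real.exp ((ρ + σ) * ‖x‖) := by
        rw [div_pow]
        field_simp

theorem IsBeurlingGevrey.conj {s ρ : ℝ} {f : E → ℂ} (hf : IsBeurlingGevrey s ρ f) :
    IsBeurlingGevrey s ρ fun x => starRingEnd ℂ (f x) := by
  refine ⟨Complex.conjCLE.contDiff.comp hf.contDiff, fun h hh => ?_⟩
  obtain ⟨C, hC, hb⟩ := hf.exists_bound h hh
  refine ⟨C, hC, fun n x => ?_⟩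
  rw [show (fun y => starRingEnd ℂ (f y)) = Complex.conjLIE ∘ f from rfl,
    LinearIsometryEquiv.norm_iteratedFDeriv_comp_left]
  exact hb n x

theorem norm_cexp_clm_le (L : E →L[ℝ] ℂ) (x : E) :
    ‖Complex.exp (L x)‖ ≤ Real.exp (‖L‖ * ‖x‖) :=
  (Complex.norm_exp_le_exp_norm _).trans (Real.exp_le_exp.2 (L.le_opNorm x))

theorem norm_iteratedFDeriv_cexp_clm_le (L : E →L[ℝ] ℂ) (n : ℕ) (x : E) :
    ‖iteratedFDeriv ℝ n (fun y => Complex.exp (L y)) x‖ ≤ ‖L‖ ^ n * ‖Complex.exp (L x)‖ := by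
  induction n with
  | zero => simp
  | succ n ih =>
    let smulL : ℂ →L[ℝ] E →L[ℝ] ℂ := (ContinuousLinearMap.toSpanSingleton ℂ L).restrictScalars ℝ
    have fderiv_eq : fderiv ℝ (fun y => Complex.exp (L y)) =
        smulL ∘ fun y => Complex.exp (L y) :=
      funext fun y => L.hasFDerivAt.cexp.fderiv
    have norm_smulL : ‖smulL‖ = ‖L‖ := by
      rw [ContinuousLinearMap.norm_restrictScalars, ContinuousLinearMap.norm_toSpanSingleton]
    calc ‖iteratedFDeriv ℝ (n + 1) (fun y => Complex.exp (L y)) x‖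
        = ‖iteratedFDeriv ℝ n (smulL ∘ fun y => Complex.exp (L y)) x‖ := by
          rw [← norm_iteratedFDeriv_fderiv, fderiv_eq]
      _ ≤ ‖smulL‖ * ‖iteratedFDeriv ℝ n (fun y => Complex.exp (L y)) x‖ :=
          smulL.norm_iteratedFDeriv_comp_left (N := ∞) L.contDiff.cexp.contDiffAt
            (by exact_mod_cast le_top)
      _ ≤ ‖L‖ * (‖L‖ ^ n * ‖Complex.exp (L x)‖) := by rw [norm_smulL]; gcongr
      _ = ‖L‖ ^ (n + 1) * ‖Complex.exp (L x)‖ := by ring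

theorem isBeurlingGevrey_cexp_clm {s : ℝ} (hs : 0 < s) (L : E →L[ℝ] ℂ) :
    IsBeurlingGevrey s ‖L‖ fun x => Complex.exp (L x) := by
  refine ⟨L.contDiff.cexp, fun h hh => ?_⟩
  obtain ⟨C, hC, hpow⟩ := pow_le_factorial ‖L‖ (norm_nonneg L) hh hs
  exact ⟨C, hC, fun n x => (norm_iteratedFDeriv_cexp_clm_le L n x).trans
    (mul_le_mul (hpow n) (norm_cexp_clm_le L x) (norm_nonneg _) (by positivity))⟩

end BeurlingGevrey

section Fourier

theorem integrable_exp_mul_norm {E : Type*} [NormedAddCommGroup E] [NormedSpace ℝ E]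
    [FiniteDimensional ℝ E] [MeasurableSpace E] [BorelSpace E] (μ : Measure E)
    [μ.IsAddHaarMeasure] {c : ℝ} (hc : c < 0) : Integrable (fun x => Real.exp (c * ‖x‖)) μ := by
  let m : ℕ := Module.finrank ℝ E + 1
  have hdecay : Integrable (fun x : E => (1 + ‖x‖) ^ (-(m : ℝ))) μ :=
    integrable_one_add_norm (by simp [m])
  refine (hdecay.const_mul (Real.exp (-c) * (m.factorial / (-c) ^ m))).mono' (by fun_prop)
    (Eventually.of_forall fun x => ?_)
  have hx : 0 < 1 + ‖x‖ := by positivity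
  have hcm : 0 < (-c) ^ m := pow_pos (neg_pos.2 hc) m
  have hpow : (-c) ^ m * (1 + ‖x‖) ^ m ≤ Real.exp (-c * (1 + ‖x‖)) * m.factorial := by
    rw [← mul_pow, ← div_le_iff₀ (by positivity)]
    exact Real.pow_div_factorial_le_exp _ (mul_nonneg (neg_pos.2 hc).le hx.le) m
  rw [Real.norm_eq_abs, Real.abs_exp, Real.rpow_neg hx.le, Real.rpow_natCast, ← div_eq_mul_inv,
    le_div_iff₀ (by positivity), ← mul_div_assoc, le_div_iff₀ hcm]
  calc Real.exp (c * ‖x‖) * (1 + ‖x‖) ^ m * (-c) ^ m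
      = Real.exp (c * ‖x‖) * ((-c) ^ m * (1 + ‖x‖) ^ m) := by ring
    _ ≤ Real.exp (c * ‖x‖) * (Real.exp (-c * (1 + ‖x‖)) * m.factorial) := by gcongr
    _ = Real.exp (-c) * m.factorial := by
      rw [← mul_assoc, ← Real.exp_add]
      ring_nf

variable {V F : Type*} [NormedAddCommGroup V] [InnerProductSpace ℝ V] [FiniteDimensional ℝ V]
  [MeasurableSpace V] [BorelSpace V] [NormedAddCommGroup F] [NormedSpace ℂ F]

theorem IsBeurlingGevrey.integrable_iteratedFDeriv {s ρ : ℝ} {f : V → F}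
    (hf : IsBeurlingGevrey s ρ f) (hρ : ρ < 0) (n : ℕ) :
    Integrable (iteratedFDeriv ℝ n f) := by
  obtain ⟨C, -, hb⟩ := hf.exists_bound 1 one_pos
  exact ((integrable_exp_mul_norm volume hρ).const_mul _).mono'
    (hf.contDiff.continuous_iteratedFDeriv (by exact_mod_cast le_top)).aestronglyMeasurable
    (Eventually.of_forall (hb n))

theorem IsBeurlingGevrey.integrable {s ρ : ℝ} {f : V → F} (hf : IsBeurlingGevrey s ρ f)
    (hρ : ρ < 0) : Integrable f := by
  rw [← integrable_norm_iff hf.contDiff.continuous.aestronglyMeasurable]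
  simpa only [norm_iteratedFDeriv_zero] using (hf.integrable_iteratedFDeriv hρ 0).norm

theorem pow_mul_norm_fourier_le {f : V → F} {n : ℕ} (hf : ContDiff ℝ n f)
    (hint : ∀ m ≤ n, Integrable (iteratedFDeriv ℝ m f)) (w : V) :
    (2 * Real.pi * ‖w‖) ^ n * ‖𝓕 f w‖ ≤ ∫ x, ‖iteratedFDeriv ℝ n f x‖ := by
  rcases (by positivity : 0 ≤ ‖w‖ ^ n).eq_or_lt with hw | hw
  · rw [mul_pow, ← hw, mul_zero, zero_mul]
    positivity
  have hfourier : 𝓕 (iteratedFDeriv ℝ n f) w (fun _ => w) =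
      (-(2 * Real.pi * Complex.I)) ^ n • (∏ _i : Fin n, -inner ℝ w w) • 𝓕 f w := by
    rw [Real.fourier_iteratedFDeriv (N := n) hf (by exact_mod_cast hint) le_rfl,
      VectorFourier.fourierPowSMulRight_apply]
    rfl
  refine le_of_mul_le_mul_right ?_ hw
  calc (2 * Real.pi * ‖w‖) ^ n * ‖𝓕 f w‖ * ‖w‖ ^ n
      = ‖𝓕 (iteratedFDeriv ℝ n f) w fun _ => w‖ := by
        simp only [hfourier, real_inner_self_eq_norm_sq, norm_smul, Finset.prod_const,
          Finset.card_univ, Fintype.card_fin, norm_pow, norm_neg, norm_mul, Complex.norm_I,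
          Complex.norm_real, Complex.norm_ofNat, norm_norm, Real.norm_of_nonneg Real.pi_pos.le]
        ring
    _ ≤ ‖𝓕 (iteratedFDeriv ℝ n f) w‖ * ‖w‖ ^ n := by
        simpa using (𝓕 (iteratedFDeriv ℝ n f) w).le_opNorm fun _ => w
    _ ≤ (∫ x, ‖iteratedFDeriv ℝ n f x‖) * ‖w‖ ^ n := by
        gcongr
        exact VectorFourier.norm_fourierIntegral_le_integral_norm _ _ _ _ _

theorem IsBeurlingGevrey.exists_pow_norm_mul_norm_fourier_le {s ρ : ℝ} {f : V → F}
    (hf : IsBeurlingGevrey s ρ f) (hρ : ρ < 0) {h : ℝ} (hh : 0 < h) :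
    ∃ C : ℝ, 0 ≤ C ∧ ∀ (n : ℕ) (ξ : V),
      ‖ξ‖ ^ n * ‖𝓕 f ((2 * Real.pi)⁻¹ • ξ)‖ ≤ C * (h ^ n * (n.factorial : ℝ) ^ s) := by
  obtain ⟨C, hC, hb⟩ := hf.exists_bound h hh
  refine ⟨C * ∫ x : V, Real.exp (ρ * ‖x‖), by positivity, fun n ξ => ?_⟩
  have hξ : ‖ξ‖ = 2 * Real.pi * ‖(2 * Real.pi)⁻¹ • ξ‖ := by
    rw [norm_smul, Real.norm_of_nonneg (by positivity), mul_inv_cancel_left₀ (by positivity)]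
  calc ‖ξ‖ ^ n * ‖𝓕 f ((2 * Real.pi)⁻¹ • ξ)‖
      ≤ ∫ x, ‖iteratedFDeriv ℝ n f x‖ := by
        rw [hξ]
        exact pow_mul_norm_fourier_le (hf.contDiff.of_le (by exact_mod_cast le_top))
          (fun m _ => hf.integrable_iteratedFDeriv hρ m) _
    _ ≤ ∫ x : V, C * (h ^ n * (n.factorial : ℝ) ^ s) * Real.exp (ρ * ‖x‖) :=
        integral_mono (hf.integrable_iteratedFDeriv hρ n).norm
          ((integrable_exp_mul_norm volume hρ).const_mul _) (hb n)
    _ = C * (∫ x : V, Real.exp (ρ * ‖x‖)) * (h ^ n * (n.factorial : ℝ) ^ s) := by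
        rw [integral_const_mul]
        ring

theorem IsBeurlingGevrey.exists_exp_mul_norm_fourier_rpow_smul_le {s ρ r ε : ℝ} {f : V → F}
    (hf : IsBeurlingGevrey s ρ f) (hρ : ρ < 0) (hs : 0 < s) (hr : 0 < r) (hε : 0 < ε) :
    ∃ C : ℝ, ∀ l : ℝ, 0 < l → ∀ ξ : V, ε ≤ ‖ξ‖ →
      Real.exp (r * l) * ‖𝓕 f ((2 * Real.pi)⁻¹ • l ^ s • ξ)‖ ≤ C := by
  obtain ⟨C, hC, hb⟩ := hf.exists_pow_norm_mul_norm_fourier_le hρ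
    (h := ε * (s / (2 * r)) ^ s) (by positivity)
  refine ⟨2 ^ s * C, fun l hl ξ hξ => ?_⟩
  have hexp : Real.exp (r * l) = Real.exp (r / s * l) ^ s := by
    rw [← Real.exp_mul]
    field_simp
  rw [hexp]
  refine exp_rpow_mul_le_of_forall_pow_rpow_mul_le hs (by positivity) (norm_nonneg _) hC
    fun n => ?_
  set b : ℝ := ‖𝓕 f ((2 * Real.pi)⁻¹ • l ^ s • ξ)‖
  have hmoment : (l ^ s) ^ n * b ≤ C * (((s / (2 * r)) ^ s) ^ n * (n.factorial : ℝ) ^ s) := by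
    refine le_of_mul_le_mul_left ?_ (pow_pos hε n)
    calc ε ^ n * ((l ^ s) ^ n * b) ≤ ‖ξ‖ ^ n * ((l ^ s) ^ n * b) := by gcongr
      _ = ‖l ^ s • ξ‖ ^ n * b := by
        rw [norm_smul, Real.norm_of_nonneg (by positivity), mul_pow]
        ring
      _ ≤ C * ((ε * (s / (2 * r)) ^ s) ^ n * (n.factorial : ℝ) ^ s) := hb n _
      _ = _ := by ring
  calc ((r / s * l) ^ n) ^ s * b = ((r / s) ^ s) ^ n * ((l ^ s) ^ n * b) := by
        rw [← Real.rpow_pow_comm (by positivity), Real.mul_rpow (by positivity) hl.le, mul_pow,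
          mul_assoc]
    _ ≤ ((r / s) ^ s) ^ n * (C * (((s / (2 * r)) ^ s) ^ n * (n.factorial : ℝ) ^ s)) := by gcongr
    _ = C * (((r / s * (s / (2 * r))) ^ s) ^ n * (n.factorial : ℝ) ^ s) := by
        rw [Real.mul_rpow (by positivity) (by positivity), mul_pow]
        ring
    _ = C * ((1 / 2) ^ n * (n.factorial : ℝ)) ^ s := by
        rw [show r / s * (s / (2 * r)) = 1 / 2 by field_simp,
          Real.mul_rpow (by positivity) (by positivity), Real.rpow_pow_comm (by positivity)]

theorem exists_fourier_ne_zero [CompleteSpace F] {f : V → F} (hf : Continuous f)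
    (hint : Integrable f) (hf0 : f ≠ 0) : ∃ ξ : V, 𝓕 f ξ ≠ 0 := by
  by_contra! h
  have hzero : 𝓕 f = 0 := funext h
  refine hf0 ?_
  rw [← hf.fourierInv_fourier_eq hint (by rw [hzero]; exact integrable_zero _ _ _), hzero]
  ext x
  simp [Real.fourierInv_eq']

end Fourier

section TestFunctions

variable {d : ℕ} {t s : ℝ} {f : Rd d → ℂ}

theorem abs_monomial_mul_norm_multiDeriv_le {h : ℝ} (ht : 0 ≤ t) (hs : 0 ≤ s) (hh : 0 < h)
    (hf : gsNorm t s h f < ⊤) (α β : Fin d → ℕ) (x : Rd d) :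
    |monomial α x| * ‖multiDeriv β f x‖ ≤ (gsNorm t s h f).toReal *
      (h ^ (length α + length β) * ((length α).factorial : ℝ) ^ t *
        ((length β).factorial : ℝ) ^ s) := by
  have hα : (0 : ℝ) < multiFactorial α := by
    exact_mod_cast Finset.prod_pos fun j _ => (α j).factorial_pos
  have hβ : (0 : ℝ) < multiFactorial β := by
    exact_mod_cast Finset.prod_pos fun j _ => (β j).factorial_pos
  calc |monomial α x| * ‖multiDeriv β f x‖
      = ‖(monomial α x : ℂ) * multiDeriv β f x‖ := by
        rw [norm_mul, Complex.norm_real, Real.norm_eq_abs]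
    _ ≤ (gsNorm t s h f).toReal * (h ^ (length α + length β) * (multiFactorial α : ℝ) ^ t *
          (multiFactorial β : ℝ) ^ s) := by
        rw [← div_le_iff₀ (by positivity), ← ENNReal.ofReal_le_iff_le_toReal hf.ne]
        exact le_iSup_of_le α (le_iSup_of_le β (le_iSup_of_le x le_rfl))
    _ ≤ _ := by
        gcongr
        exacts [multiFactorial_le α, multiFactorial_le β]

theorem pow_norm_mul_norm_iteratedFDeriv_le {h : ℝ} (ht : 0 ≤ t) (hs : 0 ≤ s) (hh : 0 < h)
    (hf : ContDiff ℝ ∞ f) (hfin : gsNorm t s h f < ⊤) (k n : ℕ) (x : Rd d) :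
    ‖x‖ ^ k * ‖iteratedFDeriv ℝ n f x‖ ≤ (gsNorm t s h f).toReal *
      ((d * h) ^ (k + n) * (k.factorial : ℝ) ^ t * (n.factorial : ℝ) ^ s) := by
  calc ‖x‖ ^ k * ‖iteratedFDeriv ℝ n f x‖
      ≤ (∑ p : Fin k → Fin d, |monomial (fun j => (List.ofFn p).count j) x|) *
          ∑ q : Fin n → Fin d, ‖multiDeriv (fun j => (List.ofFn q).count j) f x‖ :=
        mul_le_mul (norm_pow_le x k) (norm_iteratedFDeriv_le hf n x) (norm_nonneg _)
          (by positivity)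
    _ ≤ ∑ _p : Fin k → Fin d, ∑ _q : Fin n → Fin d, (gsNorm t s h f).toReal *
          (h ^ (k + n) * (k.factorial : ℝ) ^ t * (n.factorial : ℝ) ^ s) := by
        rw [Finset.sum_mul_sum]
        refine Finset.sum_le_sum fun p _ => Finset.sum_le_sum fun q _ => ?_
        simpa only [length_count, List.length_ofFn] using
          abs_monomial_mul_norm_multiDeriv_le ht hs hh hfin (fun j => (List.ofFn p).count j)
            (fun j => (List.ofFn q).count j) x
    _ = _ := by
        simp only [Finset.sum_const, Finset.card_univ, Fintype.card_pi, Fintype.card_fin,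
          Finset.prod_const, nsmul_eq_mul, Nat.cast_pow, mul_pow, pow_add (d : ℝ)]
        ring

theorem norm_iteratedFDeriv_le_mul_exp {R h : ℝ} (ht : 0 ≤ t) (ht1 : t ≤ 1) (hs : 0 ≤ s)
    (hR : 0 ≤ R) (hh : 0 < h) (hRh : R * (d * h) ≤ 1 / 2) (hf : ContDiff ℝ ∞ f)
    (hfin : gsNorm t s h f < ⊤) (n : ℕ) (x : Rd d) :
    ‖iteratedFDeriv ℝ n f x‖ ≤ 2 * (gsNorm t s h f).toReal *
      ((d * h) ^ n * (n.factorial : ℝ) ^ s) * Real.exp (-R * ‖x‖) := by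
  let M : ℝ := (gsNorm t s h f).toReal * ((d * h) ^ n * (n.factorial : ℝ) ^ s)
  have hexp : Real.exp (R * ‖x‖) * ‖iteratedFDeriv ℝ n f x‖ ≤ 2 * M := by
    refine exp_mul_le_of_forall_pow_mul_le fun k => ?_
    calc (R * ‖x‖) ^ k * ‖iteratedFDeriv ℝ n f x‖
        = R ^ k * (‖x‖ ^ k * ‖iteratedFDeriv ℝ n f x‖) := by ring
      _ ≤ R ^ k * ((gsNorm t s h f).toReal *
            ((d * h) ^ (k + n) * (k.factorial : ℝ) ^ t * (n.factorial : ℝ) ^ s)) :=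
          mul_le_mul_of_nonneg_left
            (pow_norm_mul_norm_iteratedFDeriv_le ht hs hh hf hfin k n x) (by positivity)
      _ = M * ((R * (d * h)) ^ k * (k.factorial : ℝ) ^ t) := by ring
      _ ≤ M * ((1 / 2) ^ k * (k.factorial : ℝ)) := by
          gcongr
          exact factorial_rpow_le ht1 k
  rwa [neg_mul, Real.exp_neg, ← div_eq_mul_inv, le_div_iff₀ (Real.exp_pos _), mul_comm,
    mul_assoc 2]

theorem isBeurlingGevrey_of_mem_gelfandShilovSpace (ht : 0 ≤ t) (ht1 : t ≤ 1) (hs : 0 ≤ s)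
    (hf : f ∈ gelfandShilovSpace d t s) (ρ : ℝ) : IsBeurlingGevrey s ρ f := by
  refine ⟨hf.1, fun h hh => ?_⟩
  let k : ℝ := min h (1 / (2 * (|ρ| + 1))) / (d + 1)
  have hk : 0 < k := by positivity
  have hdk : d * k ≤ min h (1 / (2 * (|ρ| + 1))) := by
    rw [mul_div_assoc', div_le_iff₀ (by positivity), mul_comm]
    gcongr
    simp
  have hρk : |ρ| * (d * k) ≤ 1 / 2 :=
    calc |ρ| * (d * k) ≤ |ρ| * (1 / (2 * (|ρ| + 1))) := by
          gcongr
          exact hdk.trans (min_le_right _ _)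
      _ ≤ 1 / 2 := by
          rw [mul_one_div, div_le_div_iff₀ (by positivity) two_pos]
          linarith
  refine ⟨2 * (gsNorm t s k f).toReal, by positivity, fun n x =>
    (norm_iteratedFDeriv_le_mul_exp ht ht1 hs (abs_nonneg ρ) hk hρk hf.1 (hf.2 k hk) n x).trans ?_⟩
  gcongr
  exacts [hdk.trans (min_le_left _ _), neg_abs_le ρ]

theorem exists_isFunction_of_norm_mul_conj_le {h : ℝ} (hh : 0 < h) {a : Rd d → ℂ} {g : Rd d → ℝ}
    (ha : AEStronglyMeasurable a) (hg : Integrable g)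
    (hag : ∀ (φ : gelfandShilovSpace d t s) (x : Rd d), ‖a x * starRingEnd ℂ ((φ : Rd d → ℂ) x)‖ ≤
      (gsNorm t s h (φ : Rd d → ℂ)).toReal * g x) :
    ∃ u : Ultradistribution d t s, u.IsFunction a := by
  have hint : ∀ φ : gelfandShilovSpace d t s,
      Integrable fun x => a x * starRingEnd ℂ ((φ : Rd d → ℂ) x) := fun φ =>
    (hg.const_mul _).mono'
      (ha.mul (Complex.continuous_conj.comp φ.2.1.continuous).aestronglyMeasurable)
      (Eventually.of_forall (hag φ))
  let pairing : gelfandShilovSpace d t s →ₛₗ[starRingEnd ℂ] ℂ :=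
    { toFun := fun φ => ∫ x, a x * starRingEnd ℂ ((φ : Rd d → ℂ) x)
      map_add' := fun φ χ => by
        rw [← integral_add (hint φ) (hint χ)]
        simp [mul_add]
      map_smul' := fun c φ => by
        rw [smul_eq_mul, ← integral_const_mul]
        simp [mul_left_comm] }
  have norm_pairing_le : ∀ φ : gelfandShilovSpace d t s,
      ‖pairing φ‖ ≤ (∫ x, g x) * (gsNorm t s h (φ : Rd d → ℂ)).toReal := fun φ => by
    rw [mul_comm, ← integral_const_mul]
    exact norm_integral_le_of_norm_le (hg.const_mul _) (Eventually.of_forall (hag φ))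
  refine ⟨⟨pairing, h, hh, (∫ x, g x).toNNReal, fun φ => ?_⟩, fun φ => ⟨hint φ, rfl⟩⟩
  calc ‖pairing φ‖ₑ = ENNReal.ofReal ‖pairing φ‖ := (ofReal_norm _).symm
    _ ≤ ENNReal.ofReal ((∫ x, g x) * (gsNorm t s h (φ : Rd d → ℂ)).toReal) :=
        ENNReal.ofReal_le_ofReal (norm_pairing_le φ)
    _ = (∫ x, g x).toNNReal * gsNorm t s h (φ : Rd d → ℂ) := by
        rw [ENNReal.ofReal_mul' ENNReal.toReal_nonneg, ENNReal.ofReal_toReal (φ.2.2 h hh).ne]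
        rfl

theorem exists_isFunction_of_norm_le_exp {A R : ℝ} (ht : 0 ≤ t) (ht1 : t ≤ 1) (hs : 0 ≤ s)
    (hR : 0 ≤ R) {a : Rd d → ℂ} (ha : AEStronglyMeasurable a)
    (hbound : ∀ x, ‖a x‖ ≤ A * Real.exp (R * ‖x‖)) :
    ∃ u : Ultradistribution d t s, u.IsFunction a := by
  let h : ℝ := 1 / (2 * (R + 1) * (d + 1))
  have hh : 0 < h := by positivity
  have hRh : (R + 1) * (d * h) ≤ 1 / 2 := by
    simp only [h]
    field_simp
    exact le_add_of_nonneg_right zero_le_one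
  refine exists_isFunction_of_norm_mul_conj_le hh ha
    ((integrable_exp_mul_norm volume (neg_one_lt_zero (R := ℝ))).const_mul (2 * A)) fun φ x => ?_
  have hφ : ‖(φ : Rd d → ℂ) x‖ ≤
      2 * (gsNorm t s h (φ : Rd d → ℂ)).toReal * Real.exp (-(R + 1) * ‖x‖) := by
    simpa using norm_iteratedFDeriv_le_mul_exp ht ht1 hs (by positivity) hh hRh φ.2.1
      (φ.2.2 h hh) 0 x
  calc ‖a x * starRingEnd ℂ ((φ : Rd d → ℂ) x)‖
      ≤ A * Real.exp (R * ‖x‖) *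
          (2 * (gsNorm t s h (φ : Rd d → ℂ)).toReal * Real.exp (-(R + 1) * ‖x‖)) := by
        rw [norm_mul, RCLike.norm_conj]
        exact mul_le_mul (hbound x) hφ (norm_nonneg _) ((norm_nonneg _).trans (hbound x))
    _ = (gsNorm t s h (φ : Rd d → ℂ)).toReal * (2 * A * Real.exp (-1 * ‖x‖)) := by
        rw [show -1 * ‖x‖ = R * ‖x‖ + -(R + 1) * ‖x‖ by ring, Real.exp_add]
        ring

end TestFunctions

section ShortTimeFourierTransform

variable {d : ℕ} {t s : ℝ}

/-- The function `e^L conj ψ`, whose Fourier transform gives the short-time Fourier transform of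
the exponential function `e^L` with window `ψ`. -/
noncomputable def twistedWindow (L : Rd d →L[ℝ] ℂ) (ψ : Rd d → ℂ) : Rd d → ℂ :=
  fun y => Complex.exp (L y) * starRingEnd ℂ (ψ y)

theorem isBeurlingGevrey_twistedWindow (ht : 0 ≤ t) (ht1 : t ≤ 1) (hs : 0 < s)
    (L : Rd d →L[ℝ] ℂ) (ψ : gelfandShilovSpace d t s) (ρ : ℝ) :
    IsBeurlingGevrey s ρ (twistedWindow L ψ) := by
  have h := (isBeurlingGevrey_cexp_clm hs L).mul hs.le
    (isBeurlingGevrey_of_mem_gelfandShilovSpace ht ht1 hs.le ψ.2 (ρ - ‖L‖)).conj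
  rwa [add_sub_cancel] at h

theorem exists_fourier_twistedWindow_ne_zero (ht : 0 ≤ t) (ht1 : t ≤ 1) (hs : 0 < s)
    (L : Rd d →L[ℝ] ℂ) {ψ : gelfandShilovSpace d t s} (hψ : ψ ≠ 0) :
    ∃ ξ, 𝓕 (twistedWindow L ψ) ξ ≠ 0 := by
  have hgevrey := isBeurlingGevrey_twistedWindow ht ht1 hs L ψ (-1)
  refine exists_fourier_ne_zero hgevrey.contDiff.continuous
    (hgevrey.integrable neg_one_lt_zero) fun h0 => hψ ?_
  ext y
  simpa [twistedWindow] using congrFun h0 y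

theorem norm_stft_cexp_clm (ht : 0 < t) (hs : 0 < s) {L : Rd d →L[ℝ] ℂ}
    {u : Ultradistribution d t s} (hu : u.IsFunction fun x => Complex.exp (L x))
    (ψ : gelfandShilovSpace d t s) (x ξ : Rd d) :
    ‖stft ht hs ψ u x ξ‖ = (2 * Real.pi) ^ (-(d : ℝ) / 2) *
      (‖Complex.exp (L x)‖ * ‖𝓕 (twistedWindow L ψ) ((2 * Real.pi)⁻¹ • ξ)‖) := by
  let phase : ℂ := Complex.exp (-(Complex.I * (inner ℝ x ξ : ℝ)))
  have norm_phase : ‖phase‖ = 1 := by simp [phase, Complex.norm_exp]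
  have pairing_eq :
      u.pairing ⟨timeFreqShift x ξ (ψ : Rd d → ℂ), timeFreqShift_mem ht hs x ξ ψ.2⟩ =
        phase * Complex.exp (L x) * 𝓕 (twistedWindow L ψ) ((2 * Real.pi)⁻¹ • ξ) := by
    rw [(hu _).2, Real.fourier_eq', ← integral_const_mul, ← integral_add_right_eq_self _ x]
    refine integral_congr_ae (Eventually.of_forall fun y => ?_)
    simp only [timeFreqShift, twistedWindow, phase, map_mul, ← Complex.exp_conj, Complex.conj_I,
      Complex.conj_ofReal, add_sub_cancel_right, smul_eq_mul, inner_smul_right, ← mul_assoc,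
      ← Complex.exp_add, map_add]
    congr 2
    rw [neg_mul 2, neg_mul (2 * Real.pi), mul_inv_cancel₀ Real.two_pi_pos.ne', inner_add_left]
    push_cast
    ring
  rw [stft, pairing_eq, norm_mul, norm_mul, norm_mul, norm_phase, one_mul, Complex.norm_real,
    Real.norm_of_nonneg (by positivity)]

end ShortTimeFourierTransform

section WaveFrontSet

theorem rpow_le_one_add {l t : ℝ} (hl : 0 ≤ l) (ht : 0 ≤ t) (ht1 : t ≤ 1) : l ^ t ≤ 1 + l := by
  rcases le_total l 1 with h | h
  · exact (Real.rpow_le_one hl h ht).trans (le_add_of_nonneg_right hl)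
  · exact (Real.rpow_le_self_of_one_le h ht1).trans (le_add_of_nonneg_left zero_le_one)

theorem abs_re_clm_rpow_smul_le {E : Type*} [SeminormedAddCommGroup E] [NormedSpace ℝ E]
    (L : E →L[ℝ] ℂ) {l t : ℝ} (hl : 0 ≤ l) (ht : 0 ≤ t) (ht1 : t ≤ 1) (x : E) :
    |(L (l ^ t • x)).re| ≤ ‖L‖ * ‖x‖ * (1 + l) :=
  calc |(L (l ^ t • x)).re| ≤ ‖L (l ^ t • x)‖ := Complex.abs_re_le_norm _
    _ ≤ ‖L‖ * (l ^ t * ‖x‖) := by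
        simpa only [norm_smul, Real.norm_of_nonneg (Real.rpow_nonneg hl t)] using
          L.le_opNorm (l ^ t • x)
    _ ≤ ‖L‖ * ((1 + l) * ‖x‖) := by
        gcongr
        exact rpow_le_one_add hl ht ht1
    _ = ‖L‖ * ‖x‖ * (1 + l) := by ring

variable {d : ℕ} {t s : ℝ} {L : Rd d →L[ℝ] ℂ} {u : Ultradistribution d t s}

theorem exists_exp_mul_norm_stft_cexp_clm_le (ht : 0 < t) (ht1 : t ≤ 1) (hs : 0 < s)
    (hu : u.IsFunction fun x => Complex.exp (L x)) (ψ : gelfandShilovSpace d t s) {r K ε : ℝ}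
    (hr : 0 < r) (hK : 0 ≤ K) (hε : 0 < ε) :
    ∃ C : ℝ, ∀ l : ℝ, 0 < l → ∀ x ξ : Rd d, ‖x‖ ≤ K → ε ≤ ‖ξ‖ →
      Real.exp (r * l) * ‖stft ht hs ψ u (l ^ t • x) (l ^ s • ξ)‖ ≤ C := by
  let R : ℝ := ‖L‖ * K
  obtain ⟨C, hb⟩ := (isBeurlingGevrey_twistedWindow ht.le ht1 hs L ψ
    (-1)).exists_exp_mul_norm_fourier_rpow_smul_le neg_one_lt_zero hs
      (show 0 < r + R by positivity) hε
  let c : ℝ := (2 * Real.pi) ^ (-(d : ℝ) / 2)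
  have : 0 ≤ c := by positivity
  refine ⟨c * (Real.exp R * C), fun l hl x ξ hx hξ => ?_⟩
  have hexp : ‖Complex.exp (L (l ^ t • x))‖ ≤ Real.exp (R * (1 + l)) := by
    rw [Complex.norm_exp, Real.exp_le_exp]
    calc (L (l ^ t • x)).re ≤ ‖L‖ * ‖x‖ * (1 + l) :=
          (le_abs_self _).trans (abs_re_clm_rpow_smul_le L hl.le ht.le ht1 x)
      _ ≤ ‖L‖ * K * (1 + l) := by gcongr
  let F : ℝ := ‖𝓕 (twistedWindow L ψ) ((2 * Real.pi)⁻¹ • l ^ s • ξ)‖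
  calc Real.exp (r * l) * ‖stft ht hs ψ u (l ^ t • x) (l ^ s • ξ)‖
      = Real.exp (r * l) * (c * (‖Complex.exp (L (l ^ t • x))‖ * F)) := by
        rw [norm_stft_cexp_clm ht hs hu]
    _ ≤ Real.exp (r * l) * (c * (Real.exp (R * (1 + l)) * F)) := by gcongr
    _ = c * (Real.exp R * (Real.exp ((r + R) * l) * F)) := by
        rw [mul_one_add R, add_mul, Real.exp_add, Real.exp_add]
        ring
    _ ≤ c * (Real.exp R * C) := by
        gcongr
        exact hb l hl ξ hξ

theorem notMem_waveFrontSet_cexp_clm (ht : 0 < t) (ht1 : t ≤ 1) (hs : 0 < s)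
    (hu : u.IsFunction fun x => Complex.exp (L x)) (ψ : gelfandShilovSpace d t s)
    {p : Rd d × Rd d} (hp : p.2 ≠ 0) : p ∉ waveFrontSet ht hs ψ u := by
  have hp_pos : 0 < ‖p.2‖ := norm_pos_iff.2 hp
  refine fun hmem => hmem.2 ⟨{q | ‖q.1‖ < ‖p.1‖ + 1 ∧ ‖p.2‖ / 2 < ‖q.2‖}, ?_, ?_, ?_,
    fun r hr => ?_⟩
  · exact (isOpen_lt continuous_fst.norm continuous_const).inter
      (isOpen_lt continuous_const continuous_snd.norm)
  · exact fun h0 => (norm_zero.trans_le (half_pos hp_pos).le).not_gt h0.2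
  · exact ⟨lt_add_one _, half_lt_self hp_pos⟩
  · obtain ⟨C, hb⟩ := exists_exp_mul_norm_stft_cexp_clm_le ht ht1 hs hu ψ hr
      (show 0 ≤ ‖p.1‖ + 1 by positivity) (half_pos hp_pos)
    exact ⟨C, fun l hl q hq => hb l hl q.1 q.2 hq.1.le hq.2.le⟩

theorem tendsto_exp_mul_norm_stft_cexp_clm (ht : 0 < t) (ht1 : t ≤ 1) (hs : 0 < s)
    (hu : u.IsFunction fun x => Complex.exp (L x)) {ψ : gelfandShilovSpace d t s} {η : Rd d}
    (hη : 𝓕 (twistedWindow L ψ) ((2 * Real.pi)⁻¹ • η) ≠ 0) (x : Rd d) :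
    Tendsto (fun l : ℝ => Real.exp ((‖L‖ * ‖x‖ + 1) * l) * ‖stft ht hs ψ u (l ^ t • x) η‖)
      atTop atTop := by
  let R : ℝ := ‖L‖ * ‖x‖
  let b : ℝ := ‖𝓕 (twistedWindow L ψ) ((2 * Real.pi)⁻¹ • η)‖
  have hb : 0 < b := norm_pos_iff.2 hη
  let c : ℝ := (2 * Real.pi) ^ (-(d : ℝ) / 2)
  have hc : 0 < c := by positivity
  have hlim : Tendsto (fun l : ℝ => Real.exp l * (Real.exp (-R) * (c * b))) atTop atTop :=
    Real.tendsto_exp_atTop.atTop_mul_const (mul_pos (Real.exp_pos _) (mul_pos hc hb))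
  refine tendsto_atTop_mono' _ ((eventually_ge_atTop 0).mono fun l hl => ?_) hlim
  have hexp : Real.exp (-(R * (1 + l))) ≤ ‖Complex.exp (L (l ^ t • x))‖ := by
    rw [Complex.norm_exp, Real.exp_le_exp]
    exact neg_le_of_abs_le (abs_re_clm_rpow_smul_le L hl ht.le ht1 x)
  calc Real.exp l * (Real.exp (-R) * (c * b))
      = Real.exp ((R + 1) * l) * (c * (Real.exp (-(R * (1 + l))) * b)) := by
        rw [← mul_assoc, ← Real.exp_add,
          show l + -R = (R + 1) * l + -(R * (1 + l)) by ring, Real.exp_add]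
        ring
    _ ≤ Real.exp ((R + 1) * l) * (c * (‖Complex.exp (L (l ^ t • x))‖ * b)) := by gcongr
    _ = Real.exp ((R + 1) * l) * ‖stft ht hs ψ u (l ^ t • x) η‖ := by
        rw [norm_stft_cexp_clm ht hs hu]

theorem mem_waveFrontSet_cexp_clm (ht : 0 < t) (ht1 : t ≤ 1) (hs : 0 < s)
    (hu : u.IsFunction fun x => Complex.exp (L x)) {ψ : gelfandShilovSpace d t s} (hψ : ψ ≠ 0)
    {x : Rd d} (hx : x ≠ 0) : (x, 0) ∈ waveFrontSet ht hs ψ u := by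
  refine ⟨fun h => hx (congrArg Prod.fst h), ?_⟩
  rintro ⟨U, hU, -, hxU, hbound⟩
  obtain ⟨ξ, hξ⟩ := exists_fourier_twistedWindow_ne_zero ht.le ht1 hs L hψ
  obtain ⟨η, rfl⟩ : ∃ η : Rd d, (2 * Real.pi)⁻¹ • η = ξ :=
    ⟨(2 * Real.pi) • ξ, inv_smul_smul₀ Real.two_pi_pos.ne' ξ⟩
  obtain ⟨C, hC⟩ := hbound (‖L‖ * ‖x‖ + 1) (by positivity)
  have hlim : Tendsto (fun l : ℝ => (x, l ^ (-s) • η)) atTop (𝓝 (x, 0)) := by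
    simpa only [zero_smul] using
      tendsto_const_nhds.prodMk_nhds ((tendsto_rpow_neg_atTop hs).smul_const η)
  obtain ⟨l, hlU, hl, hlC⟩ := ((hlim.eventually (hU.mem_nhds hxU)).and
    ((eventually_gt_atTop 0).and
      ((tendsto_exp_mul_norm_stft_cexp_clm ht ht1 hs hu hξ x).eventually_gt_atTop C))).exists
  have hle := hC l hl _ hlU
  rw [smul_smul, ← Real.rpow_add hl, add_neg_cancel, Real.rpow_zero, one_smul] at hle
  exact hlC.not_ge hle

theorem waveFrontSet_cexp_clm (ht : 0 < t) (ht1 : t ≤ 1) (hs : 0 < s)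
    (hu : u.IsFunction fun x => Complex.exp (L x)) {ψ : gelfandShilovSpace d t s} (hψ : ψ ≠ 0) :
    waveFrontSet ht hs ψ u = {p : Rd d × Rd d | p.1 ≠ 0 ∧ p.2 = 0} := by
  ext ⟨x, ξ⟩
  constructor
  · intro hmem
    have hξ : ξ = 0 :=
      not_not.1 fun h => notMem_waveFrontSet_cexp_clm ht ht1 hs hu ψ (p := (x, ξ)) h hmem
    exact ⟨fun hx => hmem.1 (Prod.ext hx hξ), hξ⟩
  · rintro ⟨hx, rfl⟩
    exact mem_waveFrontSet_cexp_clm ht ht1 hs hu hψ hx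

end WaveFrontSet

/-- The linear form `x ↦ ⟨x, z⟩ = ∑ x_j z_j`. -/
noncomputable def linForm {d : ℕ} (z : Fin d → ℂ) : Rd d →L[ℝ] ℂ :=
  ∑ j, z j • (Complex.ofRealCLM.comp (EuclideanSpace.proj j))

theorem linForm_apply {d : ℕ} (z : Fin d → ℂ) (x : Rd d) :
    linForm z x = ∑ j, (x j : ℂ) * z j := by
  simp [linForm, mul_comm]

end GelfandShilov

theorem proposition8p1 (d : ℕ) (t s : ℝ) (ht : 0 < t) (ht1 : t ≤ 1) (hs : 0 < s)
    (hst : 1 < s + t) (z : EuclideanSpace ℂ (Fin d)) :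
    (∃ u : GelfandShilov.Ultradistribution d t s,
      u.IsFunction fun x => Complex.exp (∑ j, (x j : ℂ) * z j)) ∧
    ∀ u : GelfandShilov.Ultradistribution d t s,
      (u.IsFunction fun x => Complex.exp (∑ j, (x j : ℂ) * z j)) →
        ∀ ψ : GelfandShilov.gelfandShilovSpace d t s, ψ ≠ 0 →
          GelfandShilov.waveFrontSet ht hs ψ u =
            {p : EuclideanSpace ℝ (Fin d) × EuclideanSpace ℝ (Fin d) | p.1 ≠ 0 ∧ p.2 = 0} := by
  simp only [← GelfandShilov.linForm_apply (fun j => z j)]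
  let L := GelfandShilov.linForm fun j => z j
  refine ⟨GelfandShilov.exists_isFunction_of_norm_le_exp (A := 1) ht.le ht1 hs.le (norm_nonneg L)
    L.continuous.cexp.aestronglyMeasurable fun x => ?_,
    fun u hu ψ hψ => GelfandShilov.waveFrontSet_cexp_clm ht ht1 hs hu hψ⟩
  simpa only [one_mul] using GelfandShilov.norm_cexp_clm_le L x
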